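/- Proposition. Let $k$ be an algebraically closed field of characteristic zero, $S=k[x_0,\dots,x_n]$, let $\prec$ be a monomial order on $S$ and let $I\subset S$ be a homogeneous ideal (for instance a saturated one, i.e. a point of a Hilbert scheme of $\mathbb P^n$). Let $\mathrm{GL}_{n+1}(k)$ act on $S$ by linear changes of coordinates, write ${\bf in}_\prec(J)$ for the ideal generated by the initial monomials of the nonzero elements of $J$, and let $$B^o=\{b\in \mathrm{GL}_{n+1}(k) : b.x_i\in \langle x_j : x_j\succeq x_i\rangle \text{ for all } i\}$$ be the opposite Borel subgroup. An ideal $J$ is called Borel fixed if $b.J=J$ for all $b\in B^o$. There is a unique ideal $\mathrm{Gin}_\prec(I)$, the primary generic initial ideal of $I$, such that the set $\{g\in \mathrm{GL}_{n+1}(k) : {\bf in}_\prec(g.I)=\mathrm{Gin}_\prec(I)\}$ is Zariski open and dense in $\mathrm{GL}_{n+1}(k)$, and $\mathrm{Gin}_\prec(I)$ is Borel fixed. Moreover, it is described by maximal Schubert cells as follows. For $m\ge 0$, an index in degree $m$ is a tuple $\vec\alpha=(\alpha(1),\dots,\alpha(d))$ of exponents of degree $m$ with $x^{\alpha(1)}\succ\dots\succ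 x^{\alpha(d)}$; indices are ordered lexicographically. Let $C''_{\vec\alpha}$ be the set of $g\in\mathrm{GL}_{n+1}(k)$ for which the initial monomials of the nonzero elements of $(g.I)_m$ span $k\langle x^{\alpha(1)},\dots,x^{\alpha(d)}\rangle$, and let $I_{\vec\alpha}$ be the saturation, with respect to $(x_0,\dots,x_n)$, of the ideal generated by $x^{\alpha(1)},\dots,x^{\alpha(d)}$. Then for every $m$ there is a maximal index $\vec\alpha^\star$ in degree $m$ with $C''_{\vec\alpha^\star}\neq\emptyset$; for it, $\mathrm{Gin}_\prec(I)_m=k\langle x^{\alpha^\star(1)},\dots,x^{\alpha^\star(d)}\rangle$, and $I_{\vec\alpha^\star}$ is Borel fixed. For all sufficiently large $m$, $I_{\vec\alpha^\star}$ is the saturation of $\mathrm{Gin}_\prec(I)$. -/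

import Mathlib

open scoped MonomialOrder Topology

namespace PrimaryGin

noncomputable section

universe u v

variable {k : Type u} [Field k] {n : ℕ}

attribute [local instance] MvPolynomial.gradedAlgebra

/-- Homogeneous ideals of `k[x_0, …, x_n]` for the standard grading. -/
def IsHomogeneousIdeal (I : Ideal (MvPolynomial (Fin (n + 1)) k)) : Prop :=
  I.IsHomogeneous (MvPolynomial.homogeneousSubmodule (Fin (n + 1)) k)

/-- The Zariski topology on (the `k`-points of) `GL_{n+1}`: the basic open sets are the
nonvanishing loci of polynomials in the matrix entries. -/
@[reducible]
def zariskiTopology (k : Type u) [Field k] (n : ℕ) :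
    TopologicalSpace (Matrix.GeneralLinearGroup (Fin (n + 1)) k) :=
  TopologicalSpace.generateFrom
    {U | ∃ f : MvPolynomial (Fin (n + 1) × Fin (n + 1)) k,
      U = {g | MvPolynomial.eval (fun p => g.1 p.1 p.2) f ≠ 0}}

/-- The linear change of coordinates `g . x_i = ∑ j, g_{j i} x_j`, extended to a ring
homomorphism of `k[x_0, …, x_n]`. -/
def coordChange (g : Matrix.GeneralLinearGroup (Fin (n + 1)) k) :
    MvPolynomial (Fin (n + 1)) k →ₐ[k] MvPolynomial (Fin (n + 1)) k :=
  MvPolynomial.aeval fun i => ∑ j, MvPolynomial.C (g.1 j i) * MvPolynomial.X j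

/-- The ideal `g . I`. -/
def act (g : Matrix.GeneralLinearGroup (Fin (n + 1)) k)
    (I : Ideal (MvPolynomial (Fin (n + 1)) k)) : Ideal (MvPolynomial (Fin (n + 1)) k) :=
  I.map (coordChange g)

/-- The initial ideal: the ideal generated by the initial monomials of the nonzero
elements of `I`. -/
def initialIdeal (ord : MonomialOrder.{0, v} (Fin (n + 1)))
    (I : Ideal (MvPolynomial (Fin (n + 1)) k)) : Ideal (MvPolynomial (Fin (n + 1)) k) :=
  Ideal.span {p | ∃ f ∈ I, f ≠ 0 ∧ p = MvPolynomial.monomial (ord.degree f) 1}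

/-- `g` lies in the opposite Borel subgroup `B°`: `g . x_i` is a combination of variables
`x_j` with `x_j ⪰ x_i`. -/
def IsOppositeBorel (ord : MonomialOrder.{0, v} (Fin (n + 1)))
    (g : Matrix.GeneralLinearGroup (Fin (n + 1)) k) : Prop :=
  ∀ i j : Fin (n + 1), Finsupp.single j 1 ≺[ord] Finsupp.single i 1 → g.1 j i = 0

/-- `J` is Borel fixed: `b . J = J` for all `b` in `B°`. -/
def IsBorelFixed (ord : MonomialOrder.{0, v} (Fin (n + 1)))
    (J : Ideal (MvPolynomial (Fin (n + 1)) k)) : Prop :=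
  ∀ b : Matrix.GeneralLinearGroup (Fin (n + 1)) k, IsOppositeBorel ord b → act b J = J

/-- `G` is the primary generic initial ideal of `I`: the stratum of those `g` for which
`in(g . I) = G` is Zariski open and dense in `GL_{n+1}`. -/
def IsPrimaryGin (ord : MonomialOrder.{0, v} (Fin (n + 1)))
    (I G : Ideal (MvPolynomial (Fin (n + 1)) k)) : Prop :=
  IsOpen[zariskiTopology k n] {g | initialIdeal ord (act g I) = G} ∧
    @Dense _ (zariskiTopology k n) {g | initialIdeal ord (act g I) = G}

/-- The saturation `⋃ j, (J : (x_0, …, x_n)^j)`; the supremum is of an increasing chain. -/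
def saturation (J : Ideal (MvPolynomial (Fin (n + 1)) k)) :
    Ideal (MvPolynomial (Fin (n + 1)) k) :=
  ⨆ j : ℕ, J.colon
    (((Ideal.span (Set.range MvPolynomial.X)) ^ j : Ideal (MvPolynomial (Fin (n + 1)) k)) :
      Set (MvPolynomial (Fin (n + 1)) k))

/-- The degree `m` part of an ideal, as a subspace of the polynomial ring. -/
def degreePart (I : Ideal (MvPolynomial (Fin (n + 1)) k)) (m : ℕ) :
    Submodule k (MvPolynomial (Fin (n + 1)) k) :=
  I.restrictScalars k ⊓ MvPolynomial.homogeneousSubmodule (Fin (n + 1)) k m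

/-- The initial subspace of a subspace `F`: the span of the initial monomials of its
nonzero elements. -/
def initialSubspace (ord : MonomialOrder.{0, v} (Fin (n + 1)))
    (F : Submodule k (MvPolynomial (Fin (n + 1)) k)) :
    Submodule k (MvPolynomial (Fin (n + 1)) k) :=
  Submodule.span k {p | ∃ f ∈ F, f ≠ 0 ∧ p = MvPolynomial.monomial (ord.degree f) 1}

/-- An index in degree `m`: a strictly decreasing tuple of exponents of degree `m`. -/
def IsIndex (ord : MonomialOrder.{0, v} (Fin (n + 1))) (m : ℕ) {d : ℕ}
    (α : Fin d → Fin (n + 1) →₀ ℕ) : Prop :=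
  (∀ i, (α i).degree = m) ∧ ∀ i j, i < j → α j ≺[ord] α i

/-- The lexicographic order on indices. -/
def IndexLT (ord : MonomialOrder.{0, v} (Fin (n + 1))) {d : ℕ}
    (α β : Fin d → Fin (n + 1) →₀ ℕ) : Prop :=
  ∃ i, (∀ j, j < i → α j = β j) ∧ α i ≺[ord] β i

/-- The coordinate subspace `k⟨x^{α(1)}, …, x^{α(d)}⟩`. -/
def monomialSpan (k : Type u) [Field k] {d : ℕ} (α : Fin d → Fin (n + 1) →₀ ℕ) :
    Submodule k (MvPolynomial (Fin (n + 1)) k) :=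
  Submodule.span k (Set.range fun i => MvPolynomial.monomial (α i) 1)

/-- The stratum of those `g` for which the degree `m` part of `g . I` lies in the Schubert
cell of `α`. -/
def schubertStratum (ord : MonomialOrder.{0, v} (Fin (n + 1)))
    (I : Ideal (MvPolynomial (Fin (n + 1)) k)) (m : ℕ) {d : ℕ}
    (α : Fin d → Fin (n + 1) →₀ ℕ) : Set (Matrix.GeneralLinearGroup (Fin (n + 1)) k) :=
  {g | initialSubspace ord (degreePart (act g I) m) = monomialSpan k α}

/-- `α` is the maximal index in degree `m` with nonempty stratum. (All indices with nonempty
stratum have the same length, the dimension of the degree `m` part of `I`.) -/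
def IsMaximalIndex (ord : MonomialOrder.{0, v} (Fin (n + 1)))
    (I : Ideal (MvPolynomial (Fin (n + 1)) k)) (m : ℕ) {d : ℕ}
    (α : Fin d → Fin (n + 1) →₀ ℕ) : Prop :=
  IsIndex ord m α ∧ (schubertStratum ord I m α).Nonempty ∧
    ∀ β : Fin d → Fin (n + 1) →₀ ℕ, IsIndex ord m β →
      (schubertStratum ord I m β).Nonempty → ¬ IndexLT ord α β

/-- The ideal `I_α`: the saturation of the ideal generated by the monomials `x^{α(i)}`. -/
def indexIdeal (k : Type u) [Field k] {d : ℕ} (α : Fin d → Fin (n + 1) →₀ ℕ) :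
    Ideal (MvPolynomial (Fin (n + 1)) k) :=
  saturation (Ideal.span (Set.range fun i => MvPolynomial.monomial (α i) 1))

end

end PrimaryGin

open scoped MatrixGroups

/-! Fix a degree `m`. For each `g`, the space `(g . I)_m` has an echelon basis with a decreasing
tuple `β` of initial exponents. By the Leibniz expansion, every nonzero Plücker coordinate `γ` of
this space is, up to a permutation, termwise at most `β`. Among the tuples that occur, take `α` with
the largest sum. If the coordinate `α` is nonzero at `g`, then `α` lies below `β` and maximality of
the sum forces `β = α`. So the stratum of `α` is the nonvanishing locus of one polynomial in `g`
(`IsGenericBasis.schubertStratum_eq`). As `GL` is irreducible over an infinite field, a coordinate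
that is nonzero somewhere on the orbit is nonzero somewhere in this stratum, hence dominated by `α`
(`IsGenericBasis.exists_perm_le`). Thus `α` dominates termwise every index with nonempty stratum,
and is the lexicographic maximum.

For Borel invariance, `k⟨x^α⟩` is a torus limit of points of the orbit, so the nonzero Plücker
coordinates of its translate by any `b` are still dominated by `α`. If `b` lies in `B°`, it only
raises monomials, which bounds them from below as well. Only the coordinate `α` survives, and `b`
fixes the subspace (`IsGenericBasis.map_monomialSpan_eq`).

The generic exponents of all degrees form an upper set. By Dickson's lemma and a dimension count,
being generic in finitely many degrees implies it in all degrees (`initialExponents_eq_iff`), so the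
stratum of the resulting monomial ideal is a finite intersection of nonempty open sets. Once `m`
bounds the degrees of the generators, truncation to degree `m` does not change the saturation. -/

namespace PrimaryGin

open MvPolynomial

/-! ### Plücker coordinates of families of polynomials. -/

section Minors

variable {σ k : Type*} [Field k] {d : ℕ}

/-- The Plücker coordinate of index `γ` of a family of polynomials. -/
noncomputable def minor (v : Fin d → MvPolynomial σ k) (γ : Fin d → σ →₀ ℕ) : k :=
  (Matrix.of fun i j => coeff (γ j) (v i)).det

theorem exists_perm_of_minor_ne_zero {v : Fin d → MvPolynomial σ k} {γ : Fin d → σ →₀ ℕ}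
    (h : minor v γ ≠ 0) : ∃ s : Equiv.Perm (Fin d), ∀ i, coeff (γ (s i)) (v i) ≠ 0 := by
  rw [minor, Matrix.det_apply] at h
  obtain ⟨s, -, hs⟩ := Finset.exists_ne_zero_of_sum_ne_zero h
  refine ⟨s⁻¹, fun i hi => hs ?_⟩
  rw [Finset.prod_eq_zero (Finset.mem_univ (s⁻¹ i)), smul_zero]
  simpa using hi

/-- A change of family multiplies all minors by one determinant. Used in both directions, this makes
nonvanishing of a coordinate a property of the spanned subspace. -/
theorem minor_ne_zero_of_mem_span {v w : Fin d → MvPolynomial σ k} {γ : Fin d → σ →₀ ℕ}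
    (hv : ∀ i, v i ∈ Submodule.span k (Set.range w)) (h : minor v γ ≠ 0) : minor w γ ≠ 0 := by
  simp only [Submodule.mem_span_range_iff_exists_fun] at hv
  choose T hT using hv
  have : minor v γ = (Matrix.of T).det * minor w γ := by
    rw [minor, minor, ← Matrix.det_mul]
    congr 1
    ext i j
    simp [← hT i, Matrix.mul_apply, coeff_sum]
  rw [this] at h
  exact right_ne_zero_of_mul h

theorem linearIndependent_of_minor_ne_zero {v : Fin d → MvPolynomial σ k} {γ : Fin d → σ →₀ ℕ}
    (h : minor v γ ≠ 0) : LinearIndependent k v := by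
  rw [Fintype.linearIndependent_iff]
  intro c hc
  have : Matrix.vecMul c (Matrix.of fun i j => coeff (γ j) (v i)) = 0 := by
    ext j
    simpa [Matrix.vecMul, dotProduct, coeff_sum] using congrArg (coeff (γ j)) hc
  exact fun i => congrFun (Matrix.eq_zero_of_vecMul_eq_zero h this) i

/-- If the only nonzero Plücker coordinates of a family are those of the monomials `x^{α(i)}`,
then all monomials occurring in the family are among the `x^{α(i)}`. -/
theorem mem_range_of_minor_ne_zero {v : Fin d → MvPolynomial σ k} {α : Fin d → σ →₀ ℕ}
    (h : minor v α ≠ 0) (hγ : ∀ γ, minor v γ ≠ 0 → Set.range γ = Set.range α) (i : Fin d)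
    {e : σ →₀ ℕ} (he : e ∈ (v i).support) : e ∈ Set.range α := by
  classical
  by_contra hne
  set M : Matrix (Fin d) (Fin d) k := Matrix.of fun i j => coeff (α j) (v i)
  -- Cramer's rule: the `j`-th entry is the minor of `α` with `α j` replaced by `e`, and it vanishes
  -- because `e` is not among the `α i`.
  have hcr : M.cramer (fun l => coeff e (v l)) = 0 := by
    ext j
    rw [Matrix.cramer_apply, Pi.zero_apply]
    by_contra hj
    have hm : minor v (Function.update α j e) ≠ 0 := by
      convert hj using 1
      rw [minor]
      congr 1
      ext a b
      by_cases hb : b = j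
      · subst hb; simp
      · simp [hb, M]
    exact hne (hγ _ hm ▸ ⟨j, by simp⟩)
  have := M.mulVec_cramer (fun l => coeff e (v l))
  rw [hcr, Matrix.mulVec_zero] at this
  have h1 := congrFun this i
  simp only [Pi.zero_apply, Pi.smul_apply, smul_eq_mul] at h1
  rcases mul_eq_zero.1 h1.symm with h2 | h2
  · exact h h2
  · exact mem_support_iff.1 he h2

end Minors

/-! ### Echelon bases and initial exponents of subspaces. -/

section Echelon

variable {σ k : Type*} [Field k] {d : ℕ} {ord : MonomialOrder σ}

/-- `v` is a basis of `F` whose initial exponents are the strictly decreasing tuple `α`. -/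
structure IsEchelonBasis (ord : MonomialOrder σ) (F : Submodule k (MvPolynomial σ k))
    (v : Fin d → MvPolynomial σ k) (α : Fin d → σ →₀ ℕ) : Prop where
  mem : ∀ i, v i ∈ F
  ne_zero : ∀ i, v i ≠ 0
  degree_eq : ∀ i, ord.degree (v i) = α i
  anti : ∀ i j, i < j → α j ≺[ord] α i
  degree_mem : ∀ f ∈ F, f ≠ 0 → ord.degree f ∈ Set.range α

namespace IsEchelonBasis

variable {F : Submodule k (MvPolynomial σ k)} {v : Fin d → MvPolynomial σ k}
  {α : Fin d → σ →₀ ℕ}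

/-- The coefficient matrix is triangular, with the leading coefficients on the diagonal. -/
theorem minor_ne_zero (h : IsEchelonBasis ord F v α) : minor v α ≠ 0 := by
  rw [minor, Matrix.det_of_isUpperTriangular]
  · refine Finset.prod_ne_zero_iff.2 fun i _ => ?_
    have := ord.leadingCoeff_ne_zero_iff.2 (h.ne_zero i)
    rwa [MonomialOrder.leadingCoeff, h.degree_eq] at this
  · intro i j hij
    exact ord.coeff_eq_zero_of_lt (by rw [h.degree_eq]; exact h.anti _ _ hij)

/-- Division algorithm: subtracting a multiple of the basis vector with the same initial exponent
lowers the initial exponent, and the order is well-founded. -/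
theorem span_eq (h : IsEchelonBasis ord F v α) : Submodule.span k (Set.range v) = F := by
  refine le_antisymm (Submodule.span_le.2 (Set.range_subset_iff.2 h.mem)) ?_
  suffices H : ∀ s : ord.syn, ∀ f ∈ F, ord.toSyn (ord.degree f) = s →
      f ∈ Submodule.span k (Set.range v) from fun f hf => H _ f hf rfl
  intro s
  induction s using WellFoundedLT.induction with
  | ind s ih =>
  rintro f hf rfl
  by_cases hf0 : f = 0
  · subst hf0; exact zero_mem _
  obtain ⟨i, hi⟩ := h.degree_mem f hf hf0
  have hlc := ord.leadingCoeff_ne_zero_iff.2 (h.ne_zero i)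
  set c := ord.leadingCoeff f / ord.leadingCoeff (v i)
  have hc : c ≠ 0 := div_ne_zero (ord.leadingCoeff_ne_zero_iff.2 hf0) hlc
  have hvi : v i ∈ Submodule.span k (Set.range v) := Submodule.subset_span ⟨i, rfl⟩
  have hsub : f - c • v i ∈ F := F.sub_mem hf (F.smul_mem _ (h.mem i))
  suffices f - c • v i ∈ Submodule.span k (Set.range v) by
    simpa using add_mem this (Submodule.smul_mem _ c hvi)
  by_cases h0 : f - c • v i = 0
  · rw [h0]; exact zero_mem _
  refine ih _ ?_ _ hsub rfl
  have hdeg : ord.degree (c • v i) = ord.degree f := by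
    rw [ord.degree_smul_of_isRegular (IsRegular.of_ne_zero hc), h.degree_eq, hi]
  refine lt_of_le_of_ne (ord.degree_sub_le.trans (by simp [hdeg])) fun he => ?_
  have he' := ord.toSyn.injective he
  have h1 := ord.coeff_degree_ne_zero_iff.2 h0
  rw [he', coeff_sub, coeff_smul] at h1
  apply h1
  have h2 : coeff (ord.degree f) (v i) = ord.leadingCoeff (v i) := by
    rw [MonomialOrder.leadingCoeff, h.degree_eq, hi]
  rw [h2, smul_eq_mul, div_mul_cancel₀ _ hlc, MonomialOrder.leadingCoeff, sub_self]

theorem finrank_eq (h : IsEchelonBasis ord F v α) : Module.finrank k F = d := by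
  rw [← h.span_eq, finrank_span_eq_card (linearIndependent_of_minor_ne_zero h.minor_ne_zero),
    Fintype.card_fin]

/-- The nonzero Plücker coordinates of a subspace are dominated by its initial exponents. -/
theorem exists_perm_le (h : IsEchelonBasis ord F v α) {γ : Fin d → σ →₀ ℕ} (hγ : minor v γ ≠ 0) :
    ∃ s : Equiv.Perm (Fin d), ∀ i, γ (s i) ≼[ord] α i := by
  obtain ⟨s, hs⟩ := exists_perm_of_minor_ne_zero hγ
  exact ⟨s, fun i => h.degree_eq i ▸ ord.le_degree (mem_support_iff.2 (hs i))⟩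

theorem setOf_degree_eq_range (h : IsEchelonBasis ord F v α) :
    {a | ∃ f ∈ F, f ≠ 0 ∧ a = ord.degree f} = Set.range α := by
  ext a
  constructor
  · rintro ⟨f, hf, hf0, rfl⟩
    exact h.degree_mem f hf hf0
  · rintro ⟨i, rfl⟩
    exact ⟨v i, h.mem i, h.ne_zero i, (h.degree_eq i).symm⟩

end IsEchelonBasis

theorem exists_isEchelonBasis [Finite σ] (ord : MonomialOrder σ) {m : ℕ}
    {F : Submodule k (MvPolynomial σ k)} (hF : F ≤ homogeneousSubmodule σ k m) :
    ∃ (d : ℕ) (v : Fin d → MvPolynomial σ k) (α : Fin d → σ →₀ ℕ), IsEchelonBasis ord F v α := by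
  classical
  set D : Set (σ →₀ ℕ) := {a | ∃ f ∈ F, f ≠ 0 ∧ ord.degree f = a}
  have hfin : D.Finite := by
    refine (Finsupp.finite_of_degree_eq m).subset ?_
    rintro a ⟨f, hf, hf0, rfl⟩
    have := ord.coeff_degree_ne_zero_iff.2 hf0
    by_contra hne
    exact this (((mem_homogeneousSubmodule _ _).1 (hF hf)).coeff_eq_zero hne)
  -- The order dual makes the increasing enumeration of `s` a decreasing tuple of exponents.
  set s : Finset ord.synᵒᵈ := hfin.toFinset.image fun a => OrderDual.toDual (ord.toSyn a)
  set α : Fin s.card → σ →₀ ℕ := fun i =>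
    ord.toSyn.symm (OrderDual.ofDual (s.orderEmbOfFin rfl i))
  have hα : Set.range α = D := by
    ext a
    have := Set.ext_iff.1 (s.range_orderEmbOfFin rfl) (OrderDual.toDual (ord.toSyn a))
    simp only [Set.mem_range, s, Finset.coe_image, Set.Finite.coe_toFinset, Set.mem_image,
      EmbeddingLike.apply_eq_iff_eq, exists_eq_right] at this
    rw [← this, Set.mem_range]
    refine exists_congr fun i => ?_
    constructor
    · rintro rfl
      simp [α]; rfl
    · intro h
      simp only [α]
      rw [AddEquiv.symm_apply_eq]
      exact h
  have hmem : ∀ i, α i ∈ D := fun i => hα ▸ ⟨i, rfl⟩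
  choose v hv hv0 hvd using hmem
  refine ⟨_, v, α, hv, hv0, hvd, fun i j hij => ?_, fun f hf hf0 => hα ▸ ⟨f, hf, hf0, rfl⟩⟩
  simp only [α, AddEquiv.apply_symm_apply]
  exact (s.orderEmbOfFin rfl).strictMono hij

end Echelon

variable {k : Type*} [Field k] {n : ℕ}

/-! ### Irreducibility of `GL` in the Zariski topology. -/

section Zariski

theorem exists_eval_ne_zero_of_isOpen {U : Set (GL (Fin (n + 1)) k)}
    (hU : IsOpen[zariskiTopology k n] U) {g : GL (Fin (n + 1)) k} (hg : g ∈ U) :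
    ∃ f : MvPolynomial (Fin (n + 1) × Fin (n + 1)) k,
      eval (fun p => g.1 p.1 p.2) f ≠ 0 ∧
        ∀ h : GL (Fin (n + 1)) k, eval (fun p => h.1 p.1 p.2) f ≠ 0 → h ∈ U := by
  induction hU with
  | basic s hs =>
    obtain ⟨f, rfl⟩ := hs
    exact ⟨f, hg, fun _ h => h⟩
  | univ => exact ⟨1, by simp, fun _ _ => trivial⟩
  | inter s t _ _ hs ht =>
    obtain ⟨f, hf, hf'⟩ := hs hg.1
    obtain ⟨f₂, hf₂, hf₂'⟩ := ht hg.2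
    refine ⟨f * f₂, by simp [hf, hf₂], fun h hh => ?_⟩
    rw [map_mul] at hh
    exact ⟨hf' h (left_ne_zero_of_mul hh), hf₂' h (right_ne_zero_of_mul hh)⟩
  | sUnion S _ ih =>
    obtain ⟨s, hs, hgs⟩ := hg
    obtain ⟨f, hf, hf'⟩ := ih s hs hgs
    exact ⟨f, hf, fun h hh => ⟨s, hs, hf' h hh⟩⟩

theorem exists_eval_ne_zero_and [Infinite k] {f f' : MvPolynomial (Fin (n + 1) × Fin (n + 1)) k}
    (hf : f ≠ 0) (hf' : f' ≠ 0) : ∃ g : GL (Fin (n + 1)) k,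
      eval (fun p => g.1 p.1 p.2) f ≠ 0 ∧ eval (fun p => g.1 p.1 p.2) f' ≠ 0 := by
  have hdet := Matrix.det_mvPolynomialX_ne_zero (Fin (n + 1)) k
  -- The generic determinant is included as a factor so that a nonvanishing point is an invertible
  -- matrix.
  have hne := mul_ne_zero (mul_ne_zero hf hf') hdet
  obtain ⟨x, hx⟩ : ∃ x, eval x (f * f' * (Matrix.mvPolynomialX (Fin (n + 1)) (Fin (n + 1)) k).det)
      ≠ 0 := by
    by_contra! h
    exact hne (MvPolynomial.funext fun x => by rw [h x, map_zero])
  simp only [map_mul] at hx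
  have hd : (Matrix.of fun i j => x (i, j)).det ≠ 0 := by
    have := right_ne_zero_of_mul hx
    rw [RingHom.map_det] at this
    convert this using 2
    ext i j
    simp
  exact ⟨Matrix.GeneralLinearGroup.mkOfDetNeZero _ hd,
    left_ne_zero_of_mul (left_ne_zero_of_mul hx), right_ne_zero_of_mul (left_ne_zero_of_mul hx)⟩

theorem inter_nonempty_of_isOpen [Infinite k] {U V : Set (GL (Fin (n + 1)) k)}
    (hU : IsOpen[zariskiTopology k n] U)
    (hV : IsOpen[zariskiTopology k n] V) (hU' : U.Nonempty) (hV' : V.Nonempty) :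
    (U ∩ V).Nonempty := by
  obtain ⟨g, hg⟩ := hU'
  obtain ⟨h, hh⟩ := hV'
  obtain ⟨f, hf, hfU⟩ := exists_eval_ne_zero_of_isOpen hU hg
  obtain ⟨f', hf', hfV⟩ := exists_eval_ne_zero_of_isOpen hV hh
  obtain ⟨a, ha, ha'⟩ := exists_eval_ne_zero_and (n := n) (f := f) (f' := f')
    (by rintro rfl; simp at hf) (by rintro rfl; simp at hf')
  exact ⟨a, hfU a ha, hfV a ha'⟩

theorem dense_of_isOpen [Infinite k] {U : Set (GL (Fin (n + 1)) k)}
    (hU : IsOpen[zariskiTopology k n] U)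
    (hU' : U.Nonempty) : @Dense _ (zariskiTopology k n) U := by
  let := zariskiTopology k n
  exact dense_iff_inter_open.2 fun V hV hV' => inter_nonempty_of_isOpen hV hU hV' hU'

theorem nonempty_of_dense {U : Set (GL (Fin (n + 1)) k)}
    (hU : @Dense _ (zariskiTopology k n) U) : U.Nonempty := by
  let := zariskiTopology k n
  exact hU.nonempty

theorem biInter_isOpen_nonempty [Infinite k] {ι : Type*} (s : Finset ι)
    {U : ι → Set (GL (Fin (n + 1)) k)}
    (hU : ∀ i ∈ s, IsOpen[zariskiTopology k n] (U i)) (hU' : ∀ i ∈ s, (U i).Nonempty) :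
    IsOpen[zariskiTopology k n] (⋂ i ∈ s, U i) ∧ (⋂ i ∈ s, U i).Nonempty := by
  classical
  let := zariskiTopology k n
  induction s using Finset.induction_on with
  | empty => simp
  | insert a s _ ih =>
    obtain ⟨h1, h2⟩ := ih (fun i hi => hU i (Finset.mem_insert_of_mem hi))
      (fun i hi => hU' i (Finset.mem_insert_of_mem hi))
    rw [Finset.set_biInter_insert]
    have ha := hU a (Finset.mem_insert_self _ _)
    exact ⟨ha.inter h1,
      inter_nonempty_of_isOpen ha h1 (hU' a (Finset.mem_insert_self _ _)) h2⟩

end Zariski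

/-! ### Linear changes of coordinates and their action on ideals. -/

section CoordChange

theorem coordChange_X (g : GL (Fin (n + 1)) k) (i : Fin (n + 1)) :
    coordChange g (X i) = ∑ j, C (g.1 j i) * X j := aeval_X _ _

theorem coordChange_mul (g h : GL (Fin (n + 1)) k) :
    coordChange (g * h) = (coordChange g).comp (coordChange h) := by
  ext1 i
  rw [AlgHom.comp_apply, coordChange_X, coordChange_X, map_sum]
  simp only [map_mul, coordChange_X, algHom_C, algebraMap_eq, Finset.mul_sum,
    Units.val_mul, Matrix.mul_apply, map_sum, Finset.sum_mul]
  rw [Finset.sum_comm]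
  refine Finset.sum_congr rfl fun j _ => Finset.sum_congr rfl fun l _ => ?_
  ring

theorem coordChange_one : coordChange (1 : GL (Fin (n + 1)) k) = AlgHom.id k _ := by
  ext1 i
  simp [coordChange_X, Matrix.one_apply]

theorem coordChange_inv_apply (g : GL (Fin (n + 1)) k) (f : MvPolynomial (Fin (n + 1)) k) :
    coordChange g⁻¹ (coordChange g f) = f := by
  rw [← AlgHom.comp_apply, ← coordChange_mul, inv_mul_cancel, coordChange_one, AlgHom.id_apply]

theorem coordChange_apply_inv (g : GL (Fin (n + 1)) k) (f : MvPolynomial (Fin (n + 1)) k) :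
    coordChange g (coordChange g⁻¹ f) = f := by
  rw [← AlgHom.comp_apply, ← coordChange_mul, mul_inv_cancel, coordChange_one, AlgHom.id_apply]

theorem coordChange_injective (g : GL (Fin (n + 1)) k) : Function.Injective (coordChange g) :=
  Function.LeftInverse.injective (coordChange_inv_apply g)

theorem act_act (g h : GL (Fin (n + 1)) k) (I : Ideal (MvPolynomial (Fin (n + 1)) k)) :
    act g (act h I) = act (g * h) I := by
  simp only [act]
  rw [Ideal.map_mapₐ, ← coordChange_mul]

theorem act_one (I : Ideal (MvPolynomial (Fin (n + 1)) k)) :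
    act (1 : GL (Fin (n + 1)) k) I = I := by
  simp only [act, coordChange_one]
  exact Ideal.map_id I

theorem act_mono (g : GL (Fin (n + 1)) k)
    {I J : Ideal (MvPolynomial (Fin (n + 1)) k)} (h : I ≤ J) :
    act g I ≤ act g J := Ideal.map_mono h

theorem coordChange_mem_act {g : GL (Fin (n + 1)) k} {I : Ideal (MvPolynomial (Fin (n + 1)) k)}
    {f : MvPolynomial (Fin (n + 1)) k} (hf : f ∈ I) : coordChange g f ∈ act g I :=
  Ideal.mem_map_of_mem (coordChange g) hf

theorem mem_act_iff {g : GL (Fin (n + 1)) k} {I : Ideal (MvPolynomial (Fin (n + 1)) k)}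
    {f : MvPolynomial (Fin (n + 1)) k} : f ∈ act g I ↔ coordChange g⁻¹ f ∈ I := by
  constructor
  · intro h
    have := coordChange_mem_act (g := g⁻¹) h
    rwa [act_act, inv_mul_cancel, act_one] at this
  · intro h
    simpa only [coordChange_apply_inv] using coordChange_mem_act (g := g) h

theorem isHomogeneous_coordChange (g : GL (Fin (n + 1)) k)
    {f : MvPolynomial (Fin (n + 1)) k} {m : ℕ} (hf : f.IsHomogeneous m) : (coordChange g f).IsHomogeneous m := by
  have := hf.aeval (n := 1) (fun i : Fin (n + 1) =>
    ∑ j, (C (g.1 j i) * X j : MvPolynomial (Fin (n + 1)) k))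
    (fun i => IsHomogeneous.sum _ _ _ fun j _ => isHomogeneous_C_mul_X _ _)
  rwa [one_mul] at this

theorem homogeneousComponent_coordChange (g : GL (Fin (n + 1)) k)
    (f : MvPolynomial (Fin (n + 1)) k) (m : ℕ) :
    homogeneousComponent m (coordChange g f) = coordChange g (homogeneousComponent m f) := by
  conv_lhs => rw [← sum_homogeneousComponent f]
  rw [map_sum, map_sum]
  have : ∀ i, homogeneousComponent m (coordChange g (homogeneousComponent i f)) =
      if i = m then coordChange g (homogeneousComponent i f) else 0 := fun i => by
    rw [homogeneousComponent_of_mem (isHomogeneous_coordChange g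
      (homogeneousComponent_isHomogeneous i f))]
    simp only [eq_comm]
  simp only [this, Finset.sum_ite_eq', Finset.mem_range]
  split_ifs with h
  · rfl
  · rw [homogeneousComponent_eq_zero _ _ (by omega), map_zero]

theorem degreePart_act (g : GL (Fin (n + 1)) k)
    (I : Ideal (MvPolynomial (Fin (n + 1)) k)) (m : ℕ) :
    degreePart (act g I) m = (degreePart I m).map (coordChange g).toLinearMap := by
  ext f
  simp only [degreePart, Submodule.mem_inf, Submodule.restrictScalars_mem, Submodule.mem_map,
    mem_homogeneousSubmodule, AlgHom.toLinearMap_apply]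
  constructor
  · rintro ⟨h1, h2⟩
    exact ⟨_, ⟨mem_act_iff.1 h1, isHomogeneous_coordChange _ h2⟩, coordChange_apply_inv g f⟩
  · rintro ⟨p, ⟨h1, h2⟩, rfl⟩
    exact ⟨coordChange_mem_act h1, isHomogeneous_coordChange g h2⟩

/-- The Plücker coordinates of `g . v` are polynomial functions of `g`. -/
theorem exists_eval_eq_minor {d : ℕ} (v : Fin d → MvPolynomial (Fin (n + 1)) k)
    (γ : Fin d → Fin (n + 1) →₀ ℕ) : ∃ f : MvPolynomial (Fin (n + 1) × Fin (n + 1)) k,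
      ∀ g : GL (Fin (n + 1)) k,
        minor (fun i => coordChange g (v i)) γ = eval (fun p => g.1 p.1 p.2) f := by
  let R := MvPolynomial (Fin (n + 1) × Fin (n + 1)) k
  -- The coordinate change by the generic matrix, which specializes to each `g`.
  let Φ : MvPolynomial (Fin (n + 1)) k →ₐ[k] MvPolynomial (Fin (n + 1)) R :=
    aeval fun i => ∑ j, C (X (j, i) : R) * X j
  have hΦ : ∀ (g : GL (Fin (n + 1)) k) f, MvPolynomial.map (eval fun p => g.1 p.1 p.2) (Φ f) =
      coordChange g f := by
    intro g f
    have : ((MvPolynomial.map (eval fun p => g.1 p.1 p.2)).comp Φ.toRingHom :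
        MvPolynomial (Fin (n + 1)) k →+* MvPolynomial (Fin (n + 1)) k) =
        (coordChange g).toRingHom := by
      refine ringHom_ext (fun c => ?_) fun i => ?_
      · simp [Φ, R, MvPolynomial.algebraMap_apply, MvPolynomial.algebraMap_eq]
      · simp [Φ, coordChange_X]
    exact DFunLike.congr_fun this f
  refine ⟨(Matrix.of fun i j => coeff (γ j) (Φ (v i))).det, fun g => ?_⟩
  rw [RingHom.map_det, minor]
  congr 1
  ext i j
  simp [← hΦ g, coeff_map]

theorem isOpen_setOf_minor_ne_zero {d : ℕ} (v : Fin d → MvPolynomial (Fin (n + 1)) k)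
    (γ : Fin d → Fin (n + 1) →₀ ℕ) :
    IsOpen[zariskiTopology k n]
      {g : GL (Fin (n + 1)) k | minor (fun i => coordChange g (v i)) γ ≠ 0} := by
  obtain ⟨f, hf⟩ := exists_eval_eq_minor v γ
  simp only [hf]
  exact TopologicalSpace.isOpen_generateFrom_of_mem ⟨f, rfl⟩

end CoordChange

/-! ### Comparison of decreasing tuples. -/

section Tuples

variable {σ : Type*} {ord : MonomialOrder σ} {d : ℕ} {α β : Fin d → σ →₀ ℕ}

theorem forall_le_of_perm_le (hα : ∀ i j, i < j → α j ≺[ord] α i)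
    (hβ : ∀ i j, i < j → β j ≺[ord] β i) {s : Equiv.Perm (Fin d)}
    (hs : ∀ i, β (s i) ≼[ord] α i) (i : Fin d) : β i ≼[ord] α i := by
  -- Pigeonhole: `s` cannot inject the indices `≥ i` into the indices `> i`.
  obtain ⟨j, hij, hsj⟩ : ∃ j, i ≤ j ∧ s j ≤ i := by
    by_contra! h
    have := Finset.card_le_card_of_injOn (s := Finset.Ici i) (t := Finset.Ioi i) s
      (fun j hj => by simpa using h j (by simpa using hj)) s.injective.injOn
    rw [Fin.card_Ici, Fin.card_Ioi] at this
    omega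
  have hle : ∀ {γ : Fin d → σ →₀ ℕ}, (∀ i j, i < j → γ j ≺[ord] γ i) → ∀ {a b}, a ≤ b →
      γ b ≼[ord] γ a := by
    intro γ hγ a b hab
    rcases hab.eq_or_lt with rfl | h
    · exact le_rfl
    · exact (hγ _ _ h).le
  exact (hle hβ hsj).trans ((hs j).trans (hle hα hij))

/-- Termwise inequalities whose sums satisfy the reverse inequality are all equalities. -/
theorem range_eq_of_perm_le {s : Equiv.Perm (Fin d)} (hs : ∀ i, β (s i) ≼[ord] α i)
    (hsum : ∑ i, ord.toSyn (α i) ≤ ∑ i, ord.toSyn (β i)) : Set.range β = Set.range α := by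
  have h1 : ∑ i, ord.toSyn (β (s i)) = ∑ i, ord.toSyn (β i) :=
    Equiv.sum_comp s fun i => ord.toSyn (β i)
  have h2 := (Finset.sum_eq_sum_iff_of_le fun i _ => hs i).1
    (le_antisymm (Finset.sum_le_sum fun i _ => hs i) (h1 ▸ hsum))
  have h3 : β ∘ s = α := funext fun i => ord.toSyn.injective (h2 i (Finset.mem_univ _))
  rw [← h3, s.surjective.range_comp]

theorem eq_of_range_eq (hα : ∀ i j, i < j → α j ≺[ord] α i)
    (hβ : ∀ i j, i < j → β j ≺[ord] β i) (h : Set.range β = Set.range α) : β = α := by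
  have := (StrictAnti.range_inj (f := ord.toSyn ∘ β) (g := ord.toSyn ∘ α)
    (fun i j hij => hβ i j hij) (fun i j hij => hα i j hij)).1 (by
      rw [Set.range_comp, Set.range_comp, h])
  exact funext fun i => ord.toSyn.injective (congrFun this i)

theorem injective_of_anti (hα : ∀ i j, i < j → α j ≺[ord] α i) : Function.Injective α := by
  have : StrictAnti (ord.toSyn ∘ α) := fun i j hij => hα i j hij
  exact this.injective.of_comp

theorem length_eq_of_range_eq {d' : ℕ} {β : Fin d' → σ →₀ ℕ} (hα : ∀ i j, i < j → α j ≺[ord] α i)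
    (hβ : ∀ i j, i < j → β j ≺[ord] β i) (h : Set.range β = Set.range α) : d' = d := by
  have h1 := Set.ncard_range_of_injective (injective_of_anti hα)
  have h2 := Set.ncard_range_of_injective (injective_of_anti hβ)
  rw [h, h1] at h2
  simpa using h2.symm

end Tuples

theorem IndexLT.not_forall_le {ord : MonomialOrder (Fin (n + 1))} {d : ℕ}
    {α β : Fin d → Fin (n + 1) →₀ ℕ} (h : IndexLT ord α β) : ¬ ∀ i, β i ≼[ord] α i := by
  obtain ⟨i, -, hi⟩ := h
  exact fun hle => (hle i).not_gt hi

theorem eq_of_forall_le_of_not_indexLT {ord : MonomialOrder (Fin (n + 1))} {d : ℕ}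
    {α β : Fin d → Fin (n + 1) →₀ ℕ} (h : ∀ i, β i ≼[ord] α i) (hlt : ¬ IndexLT ord β α) :
    β = α := by
  by_contra hne
  have hex : ∃ i, β i ≠ α i := Function.ne_iff.1 hne
  obtain ⟨i, hi, hmin⟩ := WellFounded.has_min (wellFounded_lt (α := Fin d)) {i | β i ≠ α i} hex
  refine hlt ⟨i, fun j hj => ?_, lt_of_le_of_ne (h i) fun he => hi (ord.toSyn.injective he)⟩
  by_contra hj'
  exact hmin j hj' hj

/-! ### Coordinate subspaces and initial subspaces. -/

section MonomialSpan

theorem monomialSpan_eq_restrictSupport {d : ℕ} (α : Fin d → Fin (n + 1) →₀ ℕ) :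
    monomialSpan k α = restrictSupport k (Set.range α) := by
  rw [restrictSupport_eq_span, ← Set.range_comp]
  rfl

theorem restrictSupport_injective {σ : Type*} {s t : Set (σ →₀ ℕ)}
    (h : restrictSupport k s = restrictSupport k t) : s = t := by
  ext a
  have := SetLike.ext_iff.1 h (monomial a 1)
  simpa [monomial_mem_restrictSupport] using this

theorem monomialSpan_eq_iff {d d' : ℕ} {α : Fin d → Fin (n + 1) →₀ ℕ}
    {β : Fin d' → Fin (n + 1) →₀ ℕ} :
    monomialSpan k α = monomialSpan k β ↔ Set.range α = Set.range β := by
  rw [monomialSpan_eq_restrictSupport, monomialSpan_eq_restrictSupport]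
  exact ⟨restrictSupport_injective, fun h => h ▸ rfl⟩

theorem initialSubspace_eq_restrictSupport (ord : MonomialOrder (Fin (n + 1)))
    (F : Submodule k (MvPolynomial (Fin (n + 1)) k)) :
    initialSubspace ord F = restrictSupport k {a | ∃ f ∈ F, f ≠ 0 ∧ a = ord.degree f} := by
  rw [restrictSupport_eq_span, initialSubspace]
  congr 1
  ext p
  constructor
  · rintro ⟨f, hf, hf0, rfl⟩
    exact ⟨_, ⟨f, hf, hf0, rfl⟩, rfl⟩
  · rintro ⟨_, ⟨f, hf, hf0, rfl⟩, rfl⟩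
    exact ⟨f, hf, hf0, rfl⟩

theorem IsEchelonBasis.initialSubspace_eq {ord : MonomialOrder (Fin (n + 1))} {d : ℕ}
    {F : Submodule k (MvPolynomial (Fin (n + 1)) k)} {v : Fin d → MvPolynomial (Fin (n + 1)) k}
    {α : Fin d → Fin (n + 1) →₀ ℕ} (h : IsEchelonBasis ord F v α) :
    initialSubspace ord F = monomialSpan k α := by
  rw [initialSubspace_eq_restrictSupport, h.setOf_degree_eq_range, monomialSpan_eq_restrictSupport]

end MonomialSpan

/-! ### The generic Schubert stratum in one degree. -/

section Generic

variable {ord : MonomialOrder (Fin (n + 1))} {I : Ideal (MvPolynomial (Fin (n + 1)) k)} {m d : ℕ}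
  {g : GL (Fin (n + 1)) k} {v : Fin d → MvPolynomial (Fin (n + 1)) k}
  {α : Fin d → Fin (n + 1) →₀ ℕ}

theorem degreePart_le (I : Ideal (MvPolynomial (Fin (n + 1)) k)) (m : ℕ) :
    degreePart I m ≤ homogeneousSubmodule (Fin (n + 1)) k m := inf_le_right

instance finiteDimensional_homogeneousSubmodule (m : ℕ) :
    FiniteDimensional k (homogeneousSubmodule (Fin (n + 1)) k m) :=
  Module.Finite.iff_fg.2 (homogeneousSubmodule_fg _ _ m)

theorem finrank_map_coordChange (g : GL (Fin (n + 1)) k)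
    (F : Submodule k (MvPolynomial (Fin (n + 1)) k)) :
    Module.finrank k (F.map (coordChange g).toLinearMap) = Module.finrank k F :=
  (Submodule.equivMapOfInjective (coordChange g).toLinearMap (coordChange_injective g)
    F).finrank_eq.symm

theorem finrank_degreePart_act (g : GL (Fin (n + 1)) k)
    (I : Ideal (MvPolynomial (Fin (n + 1)) k)) (m : ℕ) :
    Module.finrank k (degreePart (act g I) m) = Module.finrank k (degreePart I m) := by
  rw [degreePart_act, finrank_map_coordChange]


theorem IsEchelonBasis.isIndex {F : Submodule k (MvPolynomial (Fin (n + 1)) k)}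
    (h : IsEchelonBasis ord F v α) (hF : F ≤ homogeneousSubmodule (Fin (n + 1)) k m) :
    IsIndex ord m α := by
  refine ⟨fun i => ?_, h.anti⟩
  by_contra hne
  have := ((mem_homogeneousSubmodule _ _).1 (hF (h.mem i))).coeff_eq_zero hne
  rw [← h.degree_eq] at this
  exact ord.coeff_degree_ne_zero_iff.2 (h.ne_zero i) this

theorem exists_isEchelonBasis_act (ord : MonomialOrder (Fin (n + 1)))
    (hd : Module.finrank k (degreePart I m) = d) (g : GL (Fin (n + 1)) k) :
    ∃ (v : Fin d → MvPolynomial (Fin (n + 1)) k) (α : Fin d → Fin (n + 1) →₀ ℕ),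
      IsEchelonBasis ord (degreePart (act g I) m) v α := by
  obtain ⟨d', v, α, h⟩ := exists_isEchelonBasis ord (degreePart_le (act g I) m)
  obtain rfl : d' = d := by rw [← h.finrank_eq, finrank_degreePart_act, hd]
  exact ⟨v, α, h⟩

theorem span_coordChange_comp (h : Submodule.span k (Set.range v) = degreePart (act g I) m)
    (a : GL (Fin (n + 1)) k) :
    Submodule.span k (Set.range fun i => coordChange a (v i)) = degreePart (act (a * g) I) m := by
  rw [← act_act, degreePart_act, ← h, Submodule.map_span, ← Set.range_comp]
  rfl

/-- `v` is an echelon basis of the degree `m` part of `g . I` whose initial exponents have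
maximal sum among all coordinate changes. -/
structure IsGenericBasis (ord : MonomialOrder (Fin (n + 1)))
    (I : Ideal (MvPolynomial (Fin (n + 1)) k)) (m : ℕ) (g : GL (Fin (n + 1)) k)
    (v : Fin d → MvPolynomial (Fin (n + 1)) k) (α : Fin d → Fin (n + 1) →₀ ℕ) : Prop where
  echelon : IsEchelonBasis ord (degreePart (act g I) m) v α
  sum_le : ∀ (a : GL (Fin (n + 1)) k) (w : Fin d → MvPolynomial (Fin (n + 1)) k)
    (β : Fin d → Fin (n + 1) →₀ ℕ), IsEchelonBasis ord (degreePart (act a I) m) w β →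
      ∑ i, ord.toSyn (β i) ≤ ∑ i, ord.toSyn (α i)

theorem exists_isGenericBasis (ord : MonomialOrder (Fin (n + 1)))
    (hd : Module.finrank k (degreePart I m) = d) :
    ∃ (g : GL (Fin (n + 1)) k) (v : Fin d → MvPolynomial (Fin (n + 1)) k)
      (α : Fin d → Fin (n + 1) →₀ ℕ), IsGenericBasis ord I m g v α := by
  set T : Set (Fin d → Fin (n + 1) →₀ ℕ) :=
    {β | ∃ a w, IsEchelonBasis ord (degreePart (act a I) m) w β}
  have hfin : T.Finite := by
    refine (Set.Finite.pi' fun _ : Fin d =>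
      Finsupp.finite_of_degree_eq (σ := Fin (n + 1)) m).subset ?_
    rintro β ⟨a, w, h⟩
    exact (h.isIndex (degreePart_le _ _)).1
  have hne : T.Nonempty := by
    obtain ⟨w, β, h⟩ := exists_isEchelonBasis_act ord hd 1
    exact ⟨β, 1, w, h⟩
  obtain ⟨α, ⟨g, v, h⟩, hmax⟩ := T.exists_max_image (fun β => ∑ i, ord.toSyn (β i)) hfin hne
  exact ⟨g, v, α, h, fun a w β hw => hmax β ⟨a, w, hw⟩⟩

namespace IsGenericBasis

theorem finrank_eq (h : IsGenericBasis ord I m g v α) :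
    Module.finrank k (degreePart I m) = d := by
  rw [← finrank_degreePart_act g, h.echelon.finrank_eq]

theorem isIndex (h : IsGenericBasis ord I m g v α) : IsIndex ord m α :=
  h.echelon.isIndex (degreePart_le _ _)

theorem span_eq (h : IsGenericBasis ord I m g v α) (a : GL (Fin (n + 1)) k) :
    Submodule.span k (Set.range fun i => coordChange a (coordChange g⁻¹ (v i))) =
      degreePart (act a I) m := by
  have := span_coordChange_comp h.echelon.span_eq (a * g⁻¹)
  rw [inv_mul_cancel_right] at this
  simpa only [coordChange_mul, AlgHom.comp_apply] using this

theorem eq_of_minor_ne_zero (h : IsGenericBasis ord I m g v α) {a : GL (Fin (n + 1)) k}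
    {w : Fin d → MvPolynomial (Fin (n + 1)) k} {β : Fin d → Fin (n + 1) →₀ ℕ}
    (hw : IsEchelonBasis ord (degreePart (act a I) m) w β) (hm : minor w α ≠ 0) : α = β := by
  obtain ⟨s, hs⟩ := hw.exists_perm_le hm
  exact eq_of_range_eq hw.anti h.echelon.anti (range_eq_of_perm_le hs (h.sum_le a w β hw))

theorem schubertStratum_eq (h : IsGenericBasis ord I m g v α) :
    schubertStratum ord I m α =
      {a | minor (fun i => coordChange a (coordChange g⁻¹ (v i))) α ≠ 0} := by
  ext a
  obtain ⟨w, β, hw⟩ := exists_isEchelonBasis_act ord h.finrank_eq a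
  have hspan := (h.span_eq a).trans hw.span_eq.symm
  have hiff : minor (fun i => coordChange a (coordChange g⁻¹ (v i))) α ≠ 0 ↔ minor w α ≠ 0 :=
    ⟨minor_ne_zero_of_mem_span fun i => hspan ▸ Submodule.subset_span ⟨i, rfl⟩,
      minor_ne_zero_of_mem_span fun i => hspan ▸ Submodule.subset_span ⟨i, rfl⟩⟩
  rw [Set.mem_ofPred_eq, hiff, schubertStratum, Set.mem_ofPred_eq, hw.initialSubspace_eq,
    monomialSpan_eq_iff]
  constructor
  · intro he
    rw [← eq_of_range_eq h.echelon.anti hw.anti he]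
    exact hw.minor_ne_zero
  · intro hm
    rw [h.eq_of_minor_ne_zero hw hm]

theorem isOpen_schubertStratum (h : IsGenericBasis ord I m g v α) :
    IsOpen[zariskiTopology k n] (schubertStratum ord I m α) :=
  h.schubertStratum_eq ▸ isOpen_setOf_minor_ne_zero _ α

theorem mem_schubertStratum (h : IsGenericBasis ord I m g v α) :
    g ∈ schubertStratum ord I m α := h.echelon.initialSubspace_eq

/-- All Plücker coordinates that are nonzero somewhere on the orbit are dominated by `α`. -/
theorem exists_perm_le [Infinite k] (h : IsGenericBasis ord I m g v α) {a : GL (Fin (n + 1)) k}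
    {w : Fin d → MvPolynomial (Fin (n + 1)) k} {γ : Fin d → Fin (n + 1) →₀ ℕ}
    (hw : ∀ i, w i ∈ degreePart (act a I) m) (hm : minor w γ ≠ 0) :
    ∃ s : Equiv.Perm (Fin d), ∀ i, γ (s i) ≼[ord] α i := by
  -- By irreducibility some `b` has both coordinates `α` and `γ` nonzero; its initial exponents are
  -- `α`, which therefore dominate `γ`.
  obtain ⟨b, hb, hb'⟩ := inter_nonempty_of_isOpen h.isOpen_schubertStratum
    (isOpen_setOf_minor_ne_zero (fun i => coordChange g⁻¹ (v i)) γ) ⟨g, h.mem_schubertStratum⟩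
    ⟨a, minor_ne_zero_of_mem_span (fun i => h.span_eq a ▸ hw i) hm⟩
  obtain ⟨u, β, hu⟩ := exists_isEchelonBasis_act ord h.finrank_eq b
  have hspan := (h.span_eq b).trans hu.span_eq.symm
  have hu' : ∀ {γ}, minor (fun i => coordChange b (coordChange g⁻¹ (v i))) γ ≠ 0 →
      minor u γ ≠ 0 :=
    minor_ne_zero_of_mem_span fun i => hspan ▸ Submodule.subset_span ⟨i, rfl⟩
  rw [h.schubertStratum_eq] at hb
  rw [h.eq_of_minor_ne_zero hu (hu' hb)]
  exact hu.exists_perm_le (hu' hb')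

theorem forall_le [Infinite k] (h : IsGenericBasis ord I m g v α) {β : Fin d → Fin (n + 1) →₀ ℕ}
    (hβ : IsIndex ord m β) (hne : (schubertStratum ord I m β).Nonempty) (i : Fin d) :
    β i ≼[ord] α i := by
  obtain ⟨a, ha⟩ := hne
  obtain ⟨w, β', hw⟩ := exists_isEchelonBasis_act ord h.finrank_eq a
  rw [schubertStratum, Set.mem_ofPred_eq, hw.initialSubspace_eq, monomialSpan_eq_iff] at ha
  rw [eq_of_range_eq hβ.2 hw.anti ha] at hw
  obtain ⟨s, hs⟩ := h.exists_perm_le hw.mem hw.minor_ne_zero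
  exact forall_le_of_perm_le h.echelon.anti hβ.2 hs i

theorem isMaximalIndex [Infinite k] (h : IsGenericBasis ord I m g v α) :
    IsMaximalIndex ord I m α :=
  ⟨h.isIndex, ⟨g, h.mem_schubertStratum⟩, fun _ hβ hne hlt =>
    IndexLT.not_forall_le hlt (h.forall_le hβ hne)⟩

/-- The tuple `α` dominates `β` termwise, so `β ≠ α` would make `β` lexicographically smaller.
Ranges are compared because the lengths agree only a posteriori. -/
theorem range_eq_of_isMaximalIndex [Infinite k] (h : IsGenericBasis ord I m g v α) {d' : ℕ}
    {β : Fin d' → Fin (n + 1) →₀ ℕ} (hβ : IsMaximalIndex ord I m β) :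
    Set.range β = Set.range α := by
  obtain ⟨a, ha⟩ := hβ.2.1
  obtain ⟨w, β', hw⟩ := exists_isEchelonBasis_act ord h.finrank_eq a
  rw [schubertStratum, Set.mem_ofPred_eq, hw.initialSubspace_eq, monomialSpan_eq_iff] at ha
  obtain rfl := length_eq_of_range_eq hβ.1.2 hw.anti ha
  rw [eq_of_forall_le_of_not_indexLT (h.forall_le hβ.1 hβ.2.1)
    (hβ.2.2 α h.isIndex ⟨g, h.mem_schubertStratum⟩)]

end IsGenericBasis

end Generic

/-! ### Borel and torus actions on monomials, and coefficients of determinants. -/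

section Borel

variable {ord : MonomialOrder (Fin (n + 1))}

theorem coordChange_monomial (g : GL (Fin (n + 1)) k) (a : Fin (n + 1) →₀ ℕ) :
    coordChange g (monomial a 1) = ∏ i, coordChange g (X i) ^ a i := by
  rw [monomial_eq, C_1, one_mul, Finsupp.prod_fintype _ _ (by simp), map_prod]
  simp only [map_pow]

/-- An element of the opposite Borel subgroup only raises monomials. -/
theorem le_of_coeff_coordChange_ne_zero {b : GL (Fin (n + 1)) k} (hb : IsOppositeBorel ord b)
    {a c : Fin (n + 1) →₀ ℕ} (h : coeff c (coordChange b (monomial a 1)) ≠ 0) : a ≼[ord] c := by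
  classical
  let Q : MvPolynomial (Fin (n + 1)) k → (Fin (n + 1) →₀ ℕ) → Prop :=
    fun p e => ∀ c ∈ p.support, e ≼[ord] c
  have hmul : ∀ {p q e f}, Q p e → Q q f → Q (p * q) (e + f) := by
    intro p q e f hp hq c hc
    obtain ⟨x, hx, y, hy, rfl⟩ := Finset.mem_add.1 (support_mul p q hc)
    rw [map_add, map_add]
    exact add_le_add (hp x hx) (hq y hy)
  have hone : Q 1 0 := fun c _ => by simp
  have hX : ∀ i, Q (coordChange b (X i)) (Finsupp.single i 1) := by
    intro i c hc
    rw [coordChange_X, mem_support_iff, coeff_sum] at hc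
    obtain ⟨j, -, hj⟩ := Finset.exists_ne_zero_of_sum_ne_zero hc
    rw [coeff_C_mul, coeff_X] at hj
    split_ifs at hj with hjc
    · rw [← hjc]
      by_contra hlt
      exact hj (by rw [hb i j (not_le.1 hlt), zero_mul])
    · simp at hj
  have hpow : ∀ {p e} (r : ℕ), Q p e → Q (p ^ r) (r • e) := by
    intro p e r hp
    induction r with
    | zero => simpa using hone
    | succ r ih => rw [pow_succ, succ_nsmul]; exact hmul ih hp
  have hprod : ∀ s : Finset (Fin (n + 1)), Q (∏ i ∈ s, coordChange b (X i) ^ a i)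
      (∑ i ∈ s, a i • Finsupp.single i 1) := by
    intro s
    induction s using Finset.induction_on with
    | empty => simpa using hone
    | insert i s hi ih =>
      rw [Finset.prod_insert hi, Finset.sum_insert hi]
      exact hmul (hpow _ (hX i)) ih
  have ha : ∑ i, a i • Finsupp.single i 1 = a := by
    ext j
    simp
  have := hprod Finset.univ c (by rwa [mem_support_iff, ← coordChange_monomial])
  rwa [ha] at this

/-- The diagonal coordinate change with weights `t`. -/
noncomputable def torus (t : Fin (n + 1) → kˣ) : GL (Fin (n + 1)) k :=
  Matrix.GeneralLinearGroup.mkOfDetNeZero (Matrix.diagonal fun i => (t i : k)) (by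
    rw [Matrix.det_diagonal]
    exact Finset.prod_ne_zero_iff.2 fun i _ => (t i).ne_zero)

theorem coordChange_torus_monomial (t : Fin (n + 1) → kˣ) (a : Fin (n + 1) →₀ ℕ) :
    coordChange (torus t) (monomial a 1) =
      eval (fun i => (t i : k)) (monomial a 1) • monomial a 1 := by
  have hX : ∀ i, coordChange (torus t) (X i) = C (t i : k) * X i := by
    intro i
    rw [coordChange_X, Finset.sum_eq_single i]
    · simp [torus, Matrix.GeneralLinearGroup.mkOfDetNeZero]
    · intro j _ hj
      simp [torus, Matrix.GeneralLinearGroup.mkOfDetNeZero, Matrix.diagonal_apply_ne _ hj]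
    · simp
  rw [coordChange_monomial]
  simp only [hX, mul_pow, Finset.prod_mul_distrib]
  rw [eval_monomial, smul_eq_C_mul, one_mul, Finsupp.prod_fintype _ _ (by simp)]
  congr 1
  · simp
  · rw [monomial_eq, C_1, one_mul, Finsupp.prod_fintype _ _ (by simp)]

/-- The polynomial in the torus weights whose value at `t` is `φ (t . f)`. -/
noncomputable def torusPolynomial {σ : Type*} (φ : MvPolynomial σ k →ₗ[k] k)
    (f : MvPolynomial σ k) : MvPolynomial σ k :=
  ∑ a ∈ f.support, monomial a (coeff a f * φ (monomial a 1))

theorem coeff_torusPolynomial {σ : Type*} (φ : MvPolynomial σ k →ₗ[k] k) (f : MvPolynomial σ k)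
    (a : σ →₀ ℕ) : coeff a (torusPolynomial φ f) = coeff a f * φ (monomial a 1) := by
  classical
  simp only [torusPolynomial, coeff_sum, coeff_monomial]
  rw [Finset.sum_ite_eq']
  split_ifs with h
  · rfl
  · rw [notMem_support_iff.1 h, zero_mul]

theorem eval_torusPolynomial (φ : MvPolynomial (Fin (n + 1)) k →ₗ[k] k)
    (f : MvPolynomial (Fin (n + 1)) k) (t : Fin (n + 1) → kˣ) :
    eval (fun i => (t i : k)) (torusPolynomial φ f) = φ (coordChange (torus t) f) := by
  conv_rhs => rw [f.as_sum]
  rw [torusPolynomial, map_sum, map_sum, map_sum]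
  refine Finset.sum_congr rfl fun a _ => ?_
  have h : monomial a (coeff a f) = coeff a f • monomial a (1 : k) := by
    rw [smul_monomial, smul_eq_mul, mul_one]
  rw [h, map_smul, coordChange_torus_monomial, map_smul, map_smul, eval_monomial, eval_monomial]
  simp only [smul_eq_mul]
  ring

theorem coeff_prod_of_degree_le {σ ι : Type*} (ord : MonomialOrder σ) (s : Finset ι)
    {P : ι → MvPolynomial σ k} {e : ι → σ →₀ ℕ} (h : ∀ i ∈ s, ord.degree (P i) ≼[ord] e i) :
    coeff (∑ i ∈ s, e i) (∏ i ∈ s, P i) = ∏ i ∈ s, coeff (e i) (P i) := by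
  classical
  induction s using Finset.induction_on with
  | empty => simp
  | insert a s ha ih =>
    have hs : ∀ i ∈ s, ord.degree (P i) ≼[ord] e i := fun i hi =>
      h i (Finset.mem_insert_of_mem hi)
    rw [Finset.prod_insert ha, Finset.sum_insert ha, Finset.prod_insert ha,
      ord.coeff_mul_of_add_of_degree_le (h a (Finset.mem_insert_self _ _)), ih hs]
    refine ord.degree_prod_le.trans ?_
    rw [map_sum, map_sum]
    exact Finset.sum_le_sum hs

/-- When row `i` has degree at most `e i`, the coefficient at the extreme exponent `∑ e i` is
multiplicative on each Leibniz term. This extracts the leading term along the torus. -/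
theorem coeff_det_of_degree_le {σ : Type*} (ord : MonomialOrder σ) {d : ℕ}
    {A : Matrix (Fin d) (Fin d) (MvPolynomial σ k)} {e : Fin d → σ →₀ ℕ}
    (h : ∀ i j, ord.degree (A i j) ≼[ord] e i) :
    coeff (∑ i, e i) A.det = (Matrix.of fun i j => coeff (e i) (A i j)).det := by
  rw [← Matrix.det_transpose A, ← Matrix.det_transpose (Matrix.of _), Matrix.det_apply,
    Matrix.det_apply, coeff_sum]
  refine Finset.sum_congr rfl fun s _ => ?_
  have := coeff_prod_of_degree_le ord Finset.univ (P := fun i => A i (s i)) (e := e)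
    fun i _ => h i (s i)
  simp only [Matrix.transpose_apply, Matrix.of_apply, ← this]
  rcases Int.units_eq_one_or (Equiv.Perm.sign s) with hs | hs <;> simp [hs]

end Borel

/-! ### Torus limits and Borel invariance of the generic initial subspace. -/

namespace IsGenericBasis

variable {ord : MonomialOrder (Fin (n + 1))} {I : Ideal (MvPolynomial (Fin (n + 1)) k)} {m d : ℕ}
  {g : GL (Fin (n + 1)) k} {v : Fin d → MvPolynomial (Fin (n + 1)) k}
  {α : Fin d → Fin (n + 1) →₀ ℕ}

/-- The Plücker coordinates of `b . ⟨x^{α(1)}, …, x^{α(d)}⟩`, a torus limit of points of the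
orbit, are dominated by `α`. -/
theorem exists_perm_le_of_coordChange_monomial [Infinite k] (h : IsGenericBasis ord I m g v α)
    (b : GL (Fin (n + 1)) k) {γ : Fin d → Fin (n + 1) →₀ ℕ}
    (hm : minor (fun i => coordChange b (monomial (α i) 1)) γ ≠ 0) :
    ∃ s : Equiv.Perm (Fin d), ∀ i, γ (s i) ≼[ord] α i := by
  let φ : Fin d → MvPolynomial (Fin (n + 1)) k →ₗ[k] k := fun j =>
    lcoeff k (γ j) ∘ₗ (coordChange b).toLinearMap
  -- The determinant of `A`, evaluated at `t`, is the coordinate `γ` of `b . t . v`. Its coefficient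
  -- at `∑ α i` is, up to the leading coefficients of `v`, the minor in `hm`.
  let A : Matrix (Fin d) (Fin d) (MvPolynomial (Fin (n + 1)) k) :=
    Matrix.of fun i j => torusPolynomial (φ j) (v i)
  have hA : A.det ≠ 0 := by
    intro h0
    have h1 := coeff_det_of_degree_le ord (A := A) (e := α) fun i j => by
      rw [ord.degree_le_iff]
      intro c hc
      replace hc : coeff c (torusPolynomial (φ j) (v i)) ≠ 0 := mem_support_iff.1 hc
      rw [coeff_torusPolynomial] at hc
      rw [← h.echelon.degree_eq]
      exact ord.le_degree (mem_support_iff.2 (left_ne_zero_of_mul hc))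
    have h2 : (Matrix.of fun i j => coeff (α i) (A i j)).det =
        (∏ i, coeff (α i) (v i)) * minor (fun i => coordChange b (monomial (α i) 1)) γ := by
      rw [minor, ← Matrix.det_mul_column]
      congr 1
      ext i j
      simp [A, coeff_torusPolynomial, φ]
    rw [h0, coeff_zero, h2] at h1
    refine mul_ne_zero (Finset.prod_ne_zero_iff.2 fun i _ => ?_) hm h1.symm
    rw [← h.echelon.degree_eq]
    exact ord.coeff_degree_ne_zero_iff.2 (h.echelon.ne_zero i)
  obtain ⟨t, ht⟩ : ∃ t : Fin (n + 1) → kˣ, eval (fun i => (t i : k)) A.det ≠ 0 := by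
    by_contra! h0
    refine hA (funext_set (fun _ => {0}ᶜ) (fun _ => (Set.finite_singleton 0).infinite_compl)
      fun x hx => ?_)
    rw [map_zero]
    exact h0 fun i => Units.mk0 (x i) (hx i trivial)
  have hspan := span_coordChange_comp h.echelon.span_eq (b * torus t)
  refine h.exists_perm_le (a := b * torus t * g)
    (w := fun i => coordChange (b * torus t) (v i))
    (fun i => hspan ▸ Submodule.subset_span ⟨i, rfl⟩) ?_
  convert ht using 1
  rw [minor, RingHom.map_det]
  congr 1
  ext i j
  simp [A, φ, eval_torusPolynomial, coordChange_mul]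

/-- The generic initial subspace is fixed by the opposite Borel subgroup. -/
theorem map_monomialSpan_eq [Infinite k] (h : IsGenericBasis ord I m g v α)
    {b : GL (Fin (n + 1)) k} (hb : IsOppositeBorel ord b) :
    (monomialSpan k α).map (coordChange b).toLinearMap = monomialSpan k α := by
  set w : Fin d → MvPolynomial (Fin (n + 1)) k := fun i => coordChange b (monomial (α i) 1)
  -- The torus limit bounds `γ` above by `α`; since `b` raises monomials, the sum of `γ` is at least
  -- that of `α`.
  have hrange : ∀ γ, minor w γ ≠ 0 → Set.range γ = Set.range α := by
    intro γ hγ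
    obtain ⟨s, hs⟩ := h.exists_perm_le_of_coordChange_monomial b hγ
    obtain ⟨s', hs'⟩ := exists_perm_of_minor_ne_zero hγ
    refine range_eq_of_perm_le hs ?_
    rw [← Equiv.sum_comp s' fun i => ord.toSyn (γ i)]
    exact Finset.sum_le_sum fun i _ => le_of_coeff_coordChange_ne_zero hb (hs' i)
  have hmap : (monomialSpan k α).map (coordChange b).toLinearMap =
      Submodule.span k (Set.range w) := by
    rw [monomialSpan, Submodule.map_span, ← Set.range_comp]
    rfl
  have hle : monomialSpan k α ≤ homogeneousSubmodule (Fin (n + 1)) k m :=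
    Submodule.span_le.2 (Set.range_subset_iff.2 fun i =>
      isHomogeneous_monomial 1 (h.isIndex.1 i))
  have hle' : (monomialSpan k α).map (coordChange b).toLinearMap ≤
      homogeneousSubmodule (Fin (n + 1)) k m := by
    rintro _ ⟨p, hp, rfl⟩
    exact isHomogeneous_coordChange b (hle hp)
  have hfin : FiniteDimensional k (monomialSpan k α) := Submodule.finiteDimensional_of_le hle
  have hd : Module.finrank k (monomialSpan k α) = d := by
    rw [monomialSpan, finrank_span_eq_card, Fintype.card_fin]
    exact (basisMonomials (Fin (n + 1)) k).linearIndependent.comp α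
      (injective_of_anti h.echelon.anti)
  obtain ⟨d', u, β, hu⟩ := exists_isEchelonBasis ord hle'
  obtain rfl : d' = d := by rw [← hu.finrank_eq, finrank_map_coordChange, hd]
  have hwβ : minor w β ≠ 0 := minor_ne_zero_of_mem_span
    (fun i => hmap ▸ hu.mem i) hu.minor_ne_zero
  have hwα : minor w α ≠ 0 := by
    rwa [← eq_of_range_eq h.echelon.anti hu.anti (hrange β hwβ)]
  refine Submodule.eq_of_le_of_finrank_eq ?_ (finrank_map_coordChange _ _)
  rw [hmap, Submodule.span_le, monomialSpan_eq_restrictSupport]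
  rintro _ ⟨i, rfl⟩
  exact fun e he => mem_range_of_minor_ne_zero hwα hrange i he

end IsGenericBasis

/-! ### Monomial ideals and upper sets of exponents. -/

section MonomialIdeal

variable {σ : Type*}

theorem mem_span_monomial_iff {A : Set (σ →₀ ℕ)} (hA : IsUpperSet A) {f : MvPolynomial σ k} :
    f ∈ Ideal.span ((fun a => monomial a (1 : k)) '' A) ↔ ∀ a ∈ f.support, a ∈ A := by
  rw [mem_ideal_span_monomial_image]
  exact forall₂_congr fun a _ => ⟨fun ⟨c, hc, hca⟩ => hA hca hc, fun h => ⟨a, h, le_rfl⟩⟩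

theorem span_monomial_injOn {A B : Set (σ →₀ ℕ)} (hA : IsUpperSet A) (hB : IsUpperSet B)
    (h : Ideal.span ((fun a => monomial a (1 : k)) '' A) =
      Ideal.span ((fun a => monomial a (1 : k)) '' B)) : A = B := by
  classical
  ext a
  have := SetLike.ext_iff.1 h (monomial a 1)
  rw [mem_span_monomial_iff hA, mem_span_monomial_iff hB, support_monomial,
    if_neg one_ne_zero] at this
  simpa only [Finset.mem_singleton, forall_eq] using this

/-- Dickson's lemma, deduced from the Noetherian property of the polynomial ring over `k`. -/
theorem exists_finset_generating_upperSet [Finite σ] (k : Type*) [Field k] (A : Set (σ →₀ ℕ)) :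
    ∃ T : Finset (σ →₀ ℕ), ↑T ⊆ A ∧ ∀ a ∈ A, ∃ t ∈ T, t ≤ a := by
  classical
  obtain ⟨s, hs, hs'⟩ := (Submodule.fg_span_iff_fg_span_finset_subset
    ((fun a => monomial a (1 : k)) '' A)).1 (IsNoetherian.noetherian (R := MvPolynomial σ k) _)
  obtain ⟨T, hT, rfl⟩ := Finset.subset_set_image_iff.1 hs
  refine ⟨T, hT, fun a ha => ?_⟩
  have h1 : monomial a (1 : k) ∈ Ideal.span ((fun a => monomial a (1 : k)) '' A) :=
    Ideal.subset_span ⟨a, ha, rfl⟩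
  rw [Ideal.span, hs', Finset.coe_image] at h1
  obtain ⟨t, ht, hta⟩ := mem_ideal_span_monomial_image.1 h1 a (by simp [support_monomial])
  exact ⟨t, ht, hta⟩

end MonomialIdeal

theorem degreePart_span_monomial {A : Set (Fin (n + 1) →₀ ℕ)} (hA : IsUpperSet A) (m : ℕ) :
    degreePart (Ideal.span ((fun a => monomial a (1 : k)) '' A)) m =
      restrictSupport k {a | a ∈ A ∧ a.degree = m} := by
  ext f
  simp only [degreePart, Submodule.mem_inf, Submodule.restrictScalars_mem,
    mem_span_monomial_iff hA, homogeneousSubmodule_eq_finsupp_supported, mem_restrictSupport_iff]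
  exact ⟨fun h a ha => ⟨h.1 a ha, h.2 ha⟩, fun h => ⟨fun a ha => (h ha).1, fun a ha => (h ha).2⟩⟩

/-! ### Initial exponents of homogeneous ideals. -/

section InitialExponents

/-- The initial exponents of the homogeneous elements of `J`. -/
def initialExponents (ord : MonomialOrder (Fin (n + 1)))
    (J : Ideal (MvPolynomial (Fin (n + 1)) k)) : Set (Fin (n + 1) →₀ ℕ) :=
  {a | ∃ f ∈ degreePart J a.degree, f ≠ 0 ∧ a = ord.degree f}

variable {ord : MonomialOrder (Fin (n + 1))} {J : Ideal (MvPolynomial (Fin (n + 1)) k)}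

theorem add_mem_initialExponents {a c : Fin (n + 1) →₀ ℕ} (ha : a ∈ initialExponents ord J) :
    a + c ∈ initialExponents ord J := by
  obtain ⟨f, hf, hf0, had⟩ := ha
  have hc : (monomial c (1 : k)) ≠ 0 := by simp
  refine ⟨f * monomial c 1, ⟨J.mul_mem_right _ hf.1, ?_⟩, mul_ne_zero hf0 hc, ?_⟩
  · rw [map_add]
    exact IsHomogeneous.mul hf.2 (isHomogeneous_monomial 1 rfl)
  · classical
    rw [ord.degree_mul hf0 hc, ord.degree_monomial, if_neg one_ne_zero, had]

theorem isUpperSet_initialExponents : IsUpperSet (initialExponents ord J) := by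
  intro a c hac ha
  rw [← add_tsub_cancel_of_le hac]
  exact add_mem_initialExponents ha

theorem mem_initialExponents_of_degreePart {m : ℕ} {f : MvPolynomial (Fin (n + 1)) k}
    (hf : f ∈ degreePart J m) (hf0 : f ≠ 0) :
    (ord.degree f).degree = m ∧ ord.degree f ∈ initialExponents ord J := by
  have hm : (ord.degree f).degree = m := by
    by_contra hne
    exact ord.coeff_degree_ne_zero_iff.2 hf0
      (((mem_homogeneousSubmodule _ _).1 hf.2).coeff_eq_zero hne)
  exact ⟨hm, f, hm ▸ hf, hf0, rfl⟩

theorem IsEchelonBasis.initialExponents_eq {m d : ℕ} {v : Fin d → MvPolynomial (Fin (n + 1)) k}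
    {α : Fin d → Fin (n + 1) →₀ ℕ} (h : IsEchelonBasis ord (degreePart J m) v α) :
    {a | a ∈ initialExponents ord J ∧ a.degree = m} = Set.range α := by
  rw [← h.setOf_degree_eq_range]
  ext a
  constructor
  · rintro ⟨ha, rfl⟩
    exact ha
  · rintro ⟨f, hf, hf0, rfl⟩
    exact (mem_initialExponents_of_degreePart hf hf0).symm

/-- The homogeneous component containing the initial monomial of `f` has that same initial monomial,
even when the order does not refine the degree. -/
theorem initialIdeal_eq_span (hJ : ∀ f ∈ J, ∀ m, homogeneousComponent m f ∈ J) :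
    initialIdeal ord J = Ideal.span ((fun a => monomial a (1 : k)) '' initialExponents ord J) := by
  rw [initialIdeal]
  congr 1
  ext p
  constructor
  · rintro ⟨f, hf, hf0, rfl⟩
    set m := (ord.degree f).degree
    have hc : coeff (ord.degree f) (homogeneousComponent m f) = coeff (ord.degree f) f := by
      rw [coeff_homogeneousComponent, if_pos rfl]
    have hne : coeff (ord.degree f) (homogeneousComponent m f) ≠ 0 :=
      hc ▸ ord.coeff_degree_ne_zero_iff.2 hf0
    refine ⟨ord.degree f, ⟨homogeneousComponent m f,
      ⟨hJ f hf m, homogeneousComponent_isHomogeneous m f⟩, ?_, ?_⟩, rfl⟩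
    · intro h0
      rw [h0, coeff_zero] at hne
      exact hne rfl
    · apply ord.toSyn.injective
      refine le_antisymm (ord.le_degree (mem_support_iff.2 hne)) (ord.degree_le_iff.2 ?_)
      intro c hc
      refine ord.le_degree (mem_support_iff.2 fun h0 => mem_support_iff.1 hc ?_)
      rw [coeff_homogeneousComponent, h0, ite_self]
  · rintro ⟨a, ⟨f, hf, hf0, rfl⟩, rfl⟩
    exact ⟨f, hf.1, hf0, rfl⟩

theorem homogeneousComponent_mem_act {I : Ideal (MvPolynomial (Fin (n + 1)) k)}
    (hI : IsHomogeneousIdeal I) (g : GL (Fin (n + 1)) k) {f : MvPolynomial (Fin (n + 1)) k}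
    (hf : f ∈ act g I) (m : ℕ) : homogeneousComponent m f ∈ act g I := by
  rw [mem_act_iff] at hf ⊢
  rw [← homogeneousComponent_coordChange]
  exact homogeneousComponent_mem_of_mem hI hf m

end InitialExponents

/-! ### Fixed ideals and saturation. -/

section Fixed

/-- An ideal spanned by subspaces fixed by `b` is fixed by `b`. -/
theorem act_span_eq {b : GL (Fin (n + 1)) k} {X : Set (MvPolynomial (Fin (n + 1)) k)}
    (h : ∀ x ∈ X, ∃ W : Submodule k (MvPolynomial (Fin (n + 1)) k), x ∈ W ∧
      (∀ p ∈ W, p ∈ Ideal.span X) ∧ W.map (coordChange b).toLinearMap = W) :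
    act b (Ideal.span X) = Ideal.span X := by
  apply le_antisymm
  · rw [act, Ideal.map_span, Ideal.span_le]
    rintro _ ⟨x, hx, rfl⟩
    obtain ⟨W, hxW, hW, hWb⟩ := h x hx
    refine hW _ ?_
    rw [← hWb]
    exact ⟨x, hxW, rfl⟩
  · rw [Ideal.span_le]
    intro x hx
    obtain ⟨W, hxW, hW, hWb⟩ := h x hx
    rw [← hWb] at hxW
    obtain ⟨p, hp, rfl⟩ := hxW
    exact coordChange_mem_act (hW p hp)

theorem mem_saturation_iff {J : Ideal (MvPolynomial (Fin (n + 1)) k)}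
    {f : MvPolynomial (Fin (n + 1)) k} :
    f ∈ saturation J ↔ ∃ j : ℕ, ∀ p ∈ idealOfVars (Fin (n + 1)) k ^ j, f * p ∈ J := by
  rw [saturation, Submodule.mem_iSup_of_directed]
  · exact exists_congr fun j => Submodule.mem_colon
  · exact Monotone.directed_le fun i j hij =>
      Submodule.colon_mono le_rfl (Ideal.pow_le_pow_right hij)

theorem saturation_mono {J K : Ideal (MvPolynomial (Fin (n + 1)) k)} (h : J ≤ K) :
    saturation J ≤ saturation K := by
  intro f hf
  rw [mem_saturation_iff] at hf ⊢
  obtain ⟨j, hj⟩ := hf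
  exact ⟨j, fun p hp => h (hj p hp)⟩

theorem coordChange_mem_pow_idealOfVars (b : GL (Fin (n + 1)) k) {j : ℕ}
    {p : MvPolynomial (Fin (n + 1)) k} (hp : p ∈ idealOfVars (Fin (n + 1)) k ^ j) :
    coordChange b p ∈ idealOfVars (Fin (n + 1)) k ^ j := by
  have h1 : (idealOfVars (Fin (n + 1)) k).map (coordChange b) ≤ idealOfVars (Fin (n + 1)) k := by
    rw [idealOfVars, Ideal.map_span, Ideal.span_le]
    rintro _ ⟨_, ⟨i, rfl⟩, rfl⟩
    rw [coordChange_X]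
    exact Ideal.sum_mem _ fun j _ => Ideal.mul_mem_left _ _ (Ideal.subset_span ⟨j, rfl⟩)
  refine Ideal.pow_right_mono h1 j ?_
  rw [← Ideal.map_pow]
  exact Ideal.mem_map_of_mem _ hp

theorem act_saturation_le {b : GL (Fin (n + 1)) k} {J : Ideal (MvPolynomial (Fin (n + 1)) k)}
    (hJ : act b J = J) : act b (saturation J) ≤ saturation J := by
  intro f hf
  rw [mem_act_iff, mem_saturation_iff] at hf
  rw [mem_saturation_iff]
  obtain ⟨j, hj⟩ := hf
  refine ⟨j, fun p hp => ?_⟩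
  rw [← hJ, mem_act_iff, map_mul]
  exact hj _ (coordChange_mem_pow_idealOfVars _ hp)

theorem act_saturation_eq {b : GL (Fin (n + 1)) k} {J : Ideal (MvPolynomial (Fin (n + 1)) k)}
    (hJ : act b J = J) : act b (saturation J) = saturation J := by
  refine le_antisymm (act_saturation_le hJ) ?_
  have hJ' : act b⁻¹ J = J := by
    conv_lhs => rw [← hJ]
    rw [act_act, inv_mul_cancel, act_one]
  have := act_mono b (act_saturation_le hJ')
  rwa [act_act, mul_inv_cancel, act_one] at this

end Fixed

/-! ### Saturation of a truncated monomial ideal. -/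

section Truncation

theorem saturation_span_monomial_eq {A : Set (Fin (n + 1) →₀ ℕ)} (hA : IsUpperSet A)
    {T : Finset (Fin (n + 1) →₀ ℕ)} (hT : ↑T ⊆ A) (hTA : ∀ a ∈ A, ∃ t ∈ T, t ≤ a) {m : ℕ}
    (hm : ∀ t ∈ T, t.degree ≤ m) :
    saturation (Ideal.span ((fun a => monomial a (1 : k)) '' {a | a ∈ A ∧ a.degree = m})) =
      saturation (Ideal.span ((fun a => monomial a (1 : k)) '' A)) := by
  classical
  refine le_antisymm (saturation_mono (Ideal.span_mono (Set.image_mono fun a ha => ha.1))) ?_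
  intro f hf
  rw [mem_saturation_iff] at hf ⊢
  obtain ⟨j, hj⟩ := hf
  -- The first `j` factors bring `f` into the full monomial ideal; the other `m` supply enough
  -- variables to pad a generator `t` to a divisor of degree exactly `m`.
  refine ⟨j + m, fun p hp => ?_⟩
  rw [pow_add] at hp
  induction hp using Submodule.mul_induction_on' with
  | add x _ y _ hx hy => rw [mul_add]; exact add_mem hx hy
  | mem_mul_mem x hx y hy =>
    rw [← mul_assoc, mem_ideal_span_monomial_image]
    intro c hc
    obtain ⟨a, ha, e, he, rfl⟩ := Finset.mem_add.1 (support_mul _ _ hc)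
    obtain ⟨t, ht, hta⟩ := hTA a ((mem_span_monomial_iff hA).1 (hj x hx) a ha)
    have hme := (mem_pow_idealOfVars_iff m y).1 hy e he
    obtain ⟨e', he', hed⟩ := e.exists_le_degree_eq (m - t.degree) (by omega)
    refine ⟨t + e', ⟨hA le_self_add (hT ht), ?_⟩, add_le_add hta he'⟩
    have := hm t ht
    rw [map_add, hed]
    omega

end Truncation

/-! ### Assembling the degrees into the generic initial ideal. -/

section Gin

variable {ord : MonomialOrder (Fin (n + 1))} {I : Ideal (MvPolynomial (Fin (n + 1)) k)}

theorem mem_schubertStratum_iff {m d : ℕ} {α : Fin d → Fin (n + 1) →₀ ℕ}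
    {a : GL (Fin (n + 1)) k} : a ∈ schubertStratum ord I m α ↔
      {c | c ∈ initialExponents ord (act a I) ∧ c.degree = m} = Set.range α := by
  obtain ⟨d', w, β, hw⟩ := exists_isEchelonBasis ord (degreePart_le (act a I) m)
  rw [hw.initialExponents_eq, schubertStratum, Set.mem_ofPred_eq, hw.initialSubspace_eq,
    monomialSpan_eq_iff]

/-- The exponents of the monomials in the generic initial ideal: those which are initial
exponents on the generic stratum of their degree. -/
def genericExponents {d : ℕ → ℕ} (α : ∀ m, Fin (d m) → Fin (n + 1) →₀ ℕ) :
    Set (Fin (n + 1) →₀ ℕ) := {a | a ∈ Set.range (α a.degree)}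

variable {d : ℕ → ℕ} {g : ℕ → GL (Fin (n + 1)) k}
  {v : ∀ m, Fin (d m) → MvPolynomial (Fin (n + 1)) k} {α : ∀ m, Fin (d m) → Fin (n + 1) →₀ ℕ}

theorem setOf_genericExponents (h : ∀ m, IsGenericBasis ord I m (g m) (v m) (α m)) (m : ℕ) :
    {a | a ∈ genericExponents α ∧ a.degree = m} = Set.range (α m) := by
  ext a
  constructor
  · rintro ⟨ha, rfl⟩
    exact ha
  · rintro ⟨i, rfl⟩
    have hi := (h m).isIndex.1 i
    exact ⟨by rw [genericExponents, Set.mem_ofPred_eq, hi]; exact ⟨i, rfl⟩, hi⟩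

/-- The generic strata of the two degrees share a point `b`, and the initial exponents of `b . I`
form an upper set. -/
theorem isUpperSet_genericExponents [Infinite k]
    (h : ∀ m, IsGenericBasis ord I m (g m) (v m) (α m)) : IsUpperSet (genericExponents α) := by
  intro a c hac ha
  obtain ⟨b, hb, hb'⟩ := inter_nonempty_of_isOpen (h a.degree).isOpen_schubertStratum
    (h c.degree).isOpen_schubertStratum ⟨_, (h _).mem_schubertStratum⟩
    ⟨_, (h _).mem_schubertStratum⟩
  rw [mem_schubertStratum_iff] at hb hb'
  have ha' : a ∈ {e | e ∈ initialExponents ord (act b I) ∧ e.degree = a.degree} := hb ▸ ha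
  have hc : c ∈ {e | e ∈ initialExponents ord (act b I) ∧ e.degree = c.degree} :=
    ⟨isUpperSet_initialExponents hac ha'.1, rfl⟩
  rw [hb'] at hc
  exact hc

/-- In each degree both sets have `d m` elements, so inclusion is equality. -/
theorem mem_schubertStratum_of_subset (h : ∀ m, IsGenericBasis ord I m (g m) (v m) (α m))
    {a : GL (Fin (n + 1)) k} (ha : genericExponents α ⊆ initialExponents ord (act a I)) (m : ℕ) :
    a ∈ schubertStratum ord I m (α m) := by
  rw [mem_schubertStratum_iff]
  obtain ⟨w, β, hw⟩ := exists_isEchelonBasis_act ord (h m).finrank_eq a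
  refine (Set.eq_of_subset_of_ncard_le ?_ ?_ ?_).symm
  · rw [← setOf_genericExponents h]
    exact fun c hc => ⟨ha hc.1, hc.2⟩
  · rw [hw.initialExponents_eq, Set.ncard_range_of_injective (injective_of_anti hw.anti),
      Set.ncard_range_of_injective (injective_of_anti (h m).echelon.anti)]
  · rw [hw.initialExponents_eq]
    exact Set.finite_range β

/-- Replaces a condition in every degree by one in the finitely many degrees of the generators `T`;
openness of the stratum rests on this. -/
theorem initialExponents_eq_iff [Infinite k] (h : ∀ m, IsGenericBasis ord I m (g m) (v m) (α m))
    {T : Finset (Fin (n + 1) →₀ ℕ)} (hT : ↑T ⊆ genericExponents α)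
    (hTA : ∀ a ∈ genericExponents α, ∃ t ∈ T, t ≤ a) (a : GL (Fin (n + 1)) k) :
    initialExponents ord (act a I) = genericExponents α ↔
      ∀ m ∈ T.image Finsupp.degree, a ∈ schubertStratum ord I m (α m) := by
  constructor
  · exact fun ha m _ => mem_schubertStratum_of_subset h ha.ge m
  · intro ha
    have hsub : genericExponents α ⊆ initialExponents ord (act a I) := by
      intro c hc
      obtain ⟨t, ht, htc⟩ := hTA c hc
      have h1 := mem_schubertStratum_iff.1 (ha t.degree (Finset.mem_image_of_mem _ ht))
      have h2 : t ∈ Set.range (α t.degree) := hT ht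
      rw [← h1] at h2
      exact isUpperSet_initialExponents htc h2.1
    refine Set.Subset.antisymm (fun c hc => ?_) hsub
    have h1 := mem_schubertStratum_iff.1 (mem_schubertStratum_of_subset h hsub c.degree)
    have h2 : c ∈ {e | e ∈ initialExponents ord (act a I) ∧ e.degree = c.degree} := ⟨hc, rfl⟩
    rw [h1] at h2
    exact h2

theorem isPrimaryGin_genericExponents [Infinite k] (hI : IsHomogeneousIdeal I)
    (h : ∀ m, IsGenericBasis ord I m (g m) (v m) (α m)) :
    IsPrimaryGin ord I (Ideal.span ((fun a => monomial a (1 : k)) '' genericExponents α)) := by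
  obtain ⟨T, hT, hTA⟩ := exists_finset_generating_upperSet k (genericExponents α)
  have heq : {a : GL (Fin (n + 1)) k | initialIdeal ord (act a I) =
      Ideal.span ((fun a => monomial a (1 : k)) '' genericExponents α)} =
      ⋂ m ∈ T.image Finsupp.degree, schubertStratum ord I m (α m) := by
    ext a
    rw [Set.mem_ofPred_eq, initialIdeal_eq_span fun f hf => homogeneousComponent_mem_act hI a hf,
      Set.mem_iInter₂, ← initialExponents_eq_iff h hT hTA]
    exact ⟨span_monomial_injOn isUpperSet_initialExponents (isUpperSet_genericExponents h),
      fun he => he ▸ rfl⟩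
  have := biInter_isOpen_nonempty (T.image Finsupp.degree)
    (U := fun m => schubertStratum ord I m (α m)) (fun m _ => (h m).isOpen_schubertStratum)
    (fun m _ => ⟨_, (h m).mem_schubertStratum⟩)
  rw [IsPrimaryGin, heq]
  exact ⟨this.1, dense_of_isOpen this.1 this.2⟩

theorem IsPrimaryGin.eq [Infinite k] {G G' : Ideal (MvPolynomial (Fin (n + 1)) k)}
    (hG : IsPrimaryGin ord I G) (hG' : IsPrimaryGin ord I G') : G' = G := by
  obtain ⟨a, ha, ha'⟩ := inter_nonempty_of_isOpen hG.1 hG'.1 (nonempty_of_dense hG.2)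
    (nonempty_of_dense hG'.2)
  exact ha'.symm.trans ha

theorem range_monomial_eq_image {m : ℕ} (h : ∀ m, IsGenericBasis ord I m (g m) (v m) (α m))
    {d' : ℕ} {β : Fin d' → Fin (n + 1) →₀ ℕ} (hβ : Set.range β = Set.range (α m)) :
    Set.range (fun i => monomial (β i) (1 : k)) =
      (fun a => monomial a (1 : k)) '' {a | a ∈ genericExponents α ∧ a.degree = m} := by
  rw [setOf_genericExponents h, ← hβ, ← Set.range_comp]
  rfl

end Gin

end PrimaryGin

theorem mainTheorem3 {k : Type*} [Field k] [IsAlgClosed k] [CharZero k] (n : ℕ)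
    (ord : MonomialOrder (Fin (n + 1)))
    (I : Ideal (MvPolynomial (Fin (n + 1)) k))
    (hI : PrimaryGin.IsHomogeneousIdeal I) :
    ∃ G : Ideal (MvPolynomial (Fin (n + 1)) k),
      PrimaryGin.IsPrimaryGin ord I G ∧
      (∀ G', PrimaryGin.IsPrimaryGin ord I G' → G' = G) ∧
      PrimaryGin.IsBorelFixed ord G ∧
      (∀ m : ℕ,
        (∃ (d : ℕ) (α : Fin d → Fin (n + 1) →₀ ℕ), PrimaryGin.IsMaximalIndex ord I m α) ∧
        ∀ (d : ℕ) (α : Fin d → Fin (n + 1) →₀ ℕ), PrimaryGin.IsMaximalIndex ord I m α →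
          PrimaryGin.degreePart G m = PrimaryGin.monomialSpan k α ∧
          PrimaryGin.IsBorelFixed ord (PrimaryGin.indexIdeal k α)) ∧
      ∃ m₀ : ℕ, ∀ m ≥ m₀, ∀ (d : ℕ) (α : Fin d → Fin (n + 1) →₀ ℕ),
        PrimaryGin.IsMaximalIndex ord I m α →
          PrimaryGin.indexIdeal k α = PrimaryGin.saturation G := by
  open PrimaryGin MvPolynomial in
  have : Infinite k := inferInstance
  -- Here `rfl` makes the length of `α m` the dimension of the degree `m` part of `I`.
  choose g v α h using fun m => exists_isGenericBasis (I := I) (m := m) ord rfl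
  set A := genericExponents α
  have hA : IsUpperSet A := isUpperSet_genericExponents h
  have hGin := isPrimaryGin_genericExponents hI h
  have hdeg : ∀ m, degreePart (Ideal.span ((fun a => monomial a (1 : k)) '' A)) m =
      monomialSpan k (α m) := fun m => by
    rw [degreePart_span_monomial hA, setOf_genericExponents h, monomialSpan_eq_restrictSupport]
  refine ⟨_, hGin, fun G' hG' => hGin.eq hG', fun b hb => act_span_eq ?_, fun m =>
    ⟨⟨_, α m, (h m).isMaximalIndex⟩, fun d β hβ => ?_⟩, ?_⟩
  · rintro _ ⟨a, ha, rfl⟩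
    exact ⟨monomialSpan k (α a.degree), hdeg a.degree ▸ ⟨Ideal.subset_span ⟨a, ha, rfl⟩,
      isHomogeneous_monomial 1 rfl⟩, fun p hp => ((hdeg a.degree).ge hp).1,
      (h a.degree).map_monomialSpan_eq hb⟩
  · have hr := (h m).range_eq_of_isMaximalIndex hβ
    have hs : monomialSpan k β = monomialSpan k (α m) := monomialSpan_eq_iff.2 hr
    refine ⟨hs ▸ hdeg m, fun b hb => act_saturation_eq (act_span_eq ?_)⟩
    intro x hx
    exact ⟨monomialSpan k β, Submodule.subset_span hx, fun p hp =>
      Submodule.span_le_restrictScalars k (MvPolynomial (Fin (n + 1)) k) _ hp,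
      hs ▸ (h m).map_monomialSpan_eq hb⟩
  · obtain ⟨T, hT, hTA⟩ := exists_finset_generating_upperSet k A
    -- The bound is the largest degree of a generator of the generic initial ideal in `T`.
    refine ⟨T.sup Finsupp.degree, fun m hm d β hβ => ?_⟩
    rw [indexIdeal, range_monomial_eq_image h ((h m).range_eq_of_isMaximalIndex hβ)]
    exact saturation_span_monomial_eq hA hT hTA fun t ht => (Finset.le_sup ht).trans hm
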